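/- Let $X_1,X_2,\dots$ be independent, identically distributed real random variables with $E(X_1)=0$ and $E(X_1^2)=1$. Put $S_n=X_1+\dots+X_n$ and, for $1\le k\le n$, let $M_n^{(k)}$ be the $k$-th largest of $X_1,\dots,X_n$ (counted with multiplicity), so that $M_n^{(1)}=\max(X_1,\dots,X_n)$. Suppose that there are constants $a_n>0$, $b_n\in\mathbb{R}$ $(n\ge 1)$ such that $$\lim_{n\to\infty}P\big(a_n(M_n^{(1)}-b_n)\le x\big)=G(x)\qquad\text{for all }x\in\mathbb{R},$$ where $G$ is one of the following distribution functions: the Gumbel distribution $\Lambda(x)=\exp(-e^{-x})$; the Fréchet distribution $\Phi_\alpha(x)=\exp(-x^{-\alpha})$ for $x>0$, $\Phi_\alpha(x)=0$ for $x\le 0$, for some $\alpha>2$; or the Weibull distribution $\Psi_\alpha(x)=\exp(-(-x)^{\alpha})$ for $x\le 0$, $\Psi_\alpha(x)=1$ for $x>0$, for some $\alpha>0$. Let $\Phi$ be the standard normal distribution function. Then for every fixed integer $k\ge 1$ and all $x,y\in\mathbb{R}$, $$\lim_{n\to\infty}P\Big(a_n(M_n^{(k)}-b_n)\le x,\ \frac{S_n}{\sqrt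 n}\le y\Big)=G(x)\sum_{i=0}^{k-1}\frac{(-\ln G(x))^i}{i!}\,\Phi(y),$$ where $(-\ln G(x))^0=1$ and the right-hand side is read as $0$ if $G(x)=0$. In particular $a_n(M_n^{(k)}-b_n)$ and $S_n/\sqrt n$ are asymptotically independent: for all $x,y\in\mathbb{R}$, $$P\Big(a_n(M_n^{(k)}-b_n)\le x,\ \frac{S_n}{\sqrt n}\le y\Big)-P\big(a_n(M_n^{(k)}-b_n)\le x\big)\,P\Big(\frac{S_n}{\sqrt n}\le y\Big)\to 0\quad(n\to\infty).$$ -/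

import Mathlib

open MeasureTheory ProbabilityTheory Filter Topology

noncomputable section

/-- The Gumbel distribution function. -/
def gumbelCDF (x : ℝ) : ℝ := Real.exp (-Real.exp (-x))

/-- The Fréchet distribution function with parameter `α`. -/
def frechetCDF (α x : ℝ) : ℝ := if x ≤ 0 then 0 else Real.exp (-x ^ (-α))

/-- The Weibull (extreme value) distribution function with parameter `α`. -/
def weibullCDF (α x : ℝ) : ℝ := if x ≤ 0 then Real.exp (-(-x) ^ α) else 1

/-- `G` is the Gumbel law, a Fréchet law with `α > 2`, or a Weibull law with `α > 0`. -/
def IsExtremeValueCDF (G : ℝ → ℝ) : Prop :=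
  G = gumbelCDF ∨ (∃ α : ℝ, 2 < α ∧ G = frechetCDF α) ∨ (∃ α : ℝ, 0 < α ∧ G = weibullCDF α)

/-- The `k`-th largest (counted with multiplicity) of the `n` numbers `x 0, …, x (n - 1)`:
entry number `k` of their list in decreasing order. Meaningful for `1 ≤ k ≤ n`. -/
def kthMax (n k : ℕ) (x : ℕ → ℝ) : ℝ :=
  (((Multiset.range n).map x).sort (· ≥ ·)).getD (k - 1) 0

/-- The standard normal distribution function. -/
def stdNormalCDF (y : ℝ) : ℝ := cdf (gaussianReal 0 1) y

/-- Two sequences of real random variables are asymptotically independent: joint distribution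
functions and products of the marginal ones differ by a null sequence, at every point. -/
def AsymptoticallyIndependent {Ω : Type*} [MeasurableSpace Ω] (P : Measure Ω)
    (U V : ℕ → Ω → ℝ) : Prop :=
  ∀ x y : ℝ, Tendsto (fun n : ℕ => P.real {ω | U n ω ≤ x ∧ V n ω ≤ y}
    - P.real {ω | U n ω ≤ x} * P.real {ω | V n ω ≤ y}) atTop (𝓝 0)

end

/-! The event that the `k`-th largest value is at most `u` says that fewer than `k` of the variables
exceed `u` (`kthMax_le_iff`), so it suffices to find the joint limit law of the exceedance count
over `u n = x / a n + b n` and the normalized sum.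

Both are sums over the same i.i.d. pairs (1{X > u n}, X / √n), so their joint characteristic
function is an `n`-th power. If G(x) > 0, the law of the maximum forces n P(X > u n) → τ = -log
G(x). One pair then has characteristic function 1 + c_n / n with c_n → τ(e^{is} - 1) - t² / 2. The
interaction of the two coordinates lives on an event of probability O(1/n), where e^{itX/√n} may be
replaced by 1, so no cross term survives. The limit is Poisson(τ) times standard normal
(`tendsto_charFun_exceedanceCount_sum`), and Lévy's continuity theorem concludes.

If G(x) = 0, both limits are 0, because the count exceeds every bound in probability
(`tendsto_measureReal_exceedanceCount_lt`). -/

/-- In a decreasing list, entry number `j` is at most `u` iff at most `j` entries exceed `u`. -/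
theorem getD_le_iff_countP_le_of_pairwise_ge {l : List ℝ} (hl : l.Pairwise (· ≥ ·)) {j : ℕ}
    (hj : j < l.length) (u : ℝ) :
    l.getD j 0 ≤ u ↔ l.countP (fun y => decide (u < y)) ≤ j := by
  induction l generalizing j with
  | nil => simp at hj
  | cons c l ih =>
    rw [List.pairwise_cons] at hl
    have hzero : c ≤ u → l.countP (fun y => decide (u < y)) = 0 := fun hc => by
      rw [List.countP_eq_zero]
      intro y hy
      simpa using (hl.1 y hy).trans hc
    cases j with
    | zero =>
      by_cases hc : u < c
      · simp [hc]
      · simp [hc, not_lt.1 hc, hzero (not_lt.1 hc)]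
    | succ j =>
      have hj' : j < l.length := by simpa using hj
      by_cases hc : u < c
      · simp [hc, ← ih hl.2 hj']
      · have h := (ih hl.2 hj').2 (by simp [hzero (not_lt.1 hc)])
        simpa [hc, List.countP_cons, hzero (not_lt.1 hc)] using h

/-- The number of indices `i < n` with `u < x i`, as a real number. -/
noncomputable def exceedanceCount (u : ℝ) (n : ℕ) (x : ℕ → ℝ) : ℝ :=
  ∑ i ∈ Finset.range n, (Set.Ioi u).indicator 1 (x i)

theorem exceedanceCount_eq_card (u : ℝ) (n : ℕ) (x : ℕ → ℝ) :
    exceedanceCount u n x = (((Finset.range n).filter (fun i => u < x i)).card : ℝ) := by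
  simp [exceedanceCount, Set.indicator_apply]

theorem kthMax_le_iff {n k : ℕ} (hk : 1 ≤ k) (hkn : k ≤ n) (x : ℕ → ℝ) (u : ℝ) :
    kthMax n k x ≤ u ↔ exceedanceCount u n x < k := by
  set l := ((Multiset.range n).map x).sort (· ≥ ·) with hl
  have hlen : l.length = n := by simp [hl]
  have hcount : l.countP (fun y => decide (u < y))
      = ((Finset.range n).filter (fun i => u < x i)).card := by
    rw [← Multiset.coe_countP, hl, Multiset.sort_eq, Multiset.countP_map]
    rfl
  rw [kthMax, ← hl, getD_le_iff_countP_le_of_pairwise_ge (hl ▸ Multiset.pairwise_sort _ _)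
    (by rw [hlen]; omega),
    hcount, exceedanceCount_eq_card, Nat.cast_lt]
  omega

/-- The count is an integer. The endpoint `k - 1/2` is no atom of a Poisson law, so this half-line
is a continuity set of the limit. -/
theorem exceedanceCount_lt_natCast_iff (k : ℕ) (u : ℝ) (n : ℕ) (x : ℕ → ℝ) :
    exceedanceCount u n x < k ↔ exceedanceCount u n x ≤ k - 1 / 2 := by
  rw [exceedanceCount_eq_card]
  constructor
  · intro h
    have : (((Finset.range n).filter (fun i => u < x i)).card : ℝ) + 1 ≤ k := by
      exact_mod_cast Nat.succ_le_of_lt (Nat.cast_lt.1 h)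
    linarith
  · intro h
    linarith

theorem measurable_exceedanceCount {Ω : Type*} [MeasurableSpace Ω] {X : ℕ → Ω → ℝ}
    (hX : ∀ i, Measurable (X i)) (u : ℝ) (n : ℕ) :
    Measurable fun ω => exceedanceCount u n (fun i => X i ω) :=
  Finset.measurable_sum _ fun i _ =>
    (measurable_one.indicator measurableSet_Ioi).comp (hX i)

/-! ### Characteristic function of one indicator–variable pair -/

section

variable {Ω : Type*} [MeasurableSpace Ω] {P : Measure Ω} [IsProbabilityMeasure P]

/-- Cauchy–Schwarz on `A`: the quadratic c ↦ ∫_A (|Y| - c)² is nonnegative, so its discriminant is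
at most 0. -/
theorem sq_setIntegral_abs_le {Y : Ω → ℝ} (hY : MemLp Y 2 P) (A : Set Ω) :
    (∫ ω in A, |Y ω| ∂P) ^ 2 ≤ P.real A * ∫ ω in A, Y ω ^ 2 ∂P := by
  have h1 : Integrable (fun ω => |Y ω|) (P.restrict A) :=
    ((hY.integrable (by norm_num)).abs).integrableOn
  have h2 : Integrable (fun ω => Y ω ^ 2) (P.restrict A) := hY.integrable_sq.integrableOn
  have h := discrim_le_zero (a := P.real A) (b := -2 * ∫ ω in A, |Y ω| ∂P)
    (c := ∫ ω in A, Y ω ^ 2 ∂P) fun c => by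
      have h0 : 0 ≤ ∫ ω in A, (Y ω ^ 2 - 2 * c * |Y ω| + c ^ 2) ∂P :=
        integral_nonneg fun ω => by
          have := sq_nonneg (|Y ω| - c)
          rw [sub_sq, sq_abs] at this
          simp only [Pi.zero_apply]
          linarith
      rw [integral_add (f := fun ω => Y ω ^ 2 - 2 * c * |Y ω|) (h2.sub (h1.const_mul _))
          (integrable_const _),
        integral_sub h2 (h1.const_mul _), integral_const_mul, setIntegral_const, smul_eq_mul] at h0
      linarith
  rw [discrim] at h
  linarith

/-- Exponentials of `Y / √n` may be replaced by `1` on events of probability `O(1 / n)`. -/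
theorem tendsto_natCast_mul_setIntegral_cexp {Y : Ω → ℝ} (hm : Measurable Y) (hY : MemLp Y 2 P)
    {A : ℕ → Set Ω} {τ : ℝ}
    (hτ : Tendsto (fun n : ℕ => n * P.real (A n)) atTop (𝓝 τ)) (t : ℝ) :
    Tendsto (fun n : ℕ => (n : ℂ) *
      ∫ ω in A n, Complex.exp (Complex.I * ((√n)⁻¹ * t * Y ω : ℝ)) ∂P) atTop (𝓝 (τ : ℂ)) := by
  have hA0 : Tendsto (fun n => P.real (A n)) atTop (𝓝 0) := by
    have h := hτ.mul (tendsto_inv_atTop_nhds_zero_nat (𝕜 := ℝ))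
    rw [mul_zero] at h
    refine h.congr' ?_
    filter_upwards [eventually_ge_atTop 1] with n hn
    have : (n : ℝ) ≠ 0 := by positivity
    field_simp
  have hr : Tendsto (fun n => ∫ ω in A n, Y ω ^ 2 ∂P) atTop (𝓝 0) := by
    refine hY.integrable_sq.tendsto_setIntegral_nhds_zero ?_
    exact (ENNReal.tendsto_toReal_iff (fun n => measure_ne_top P (A n)) ENNReal.zero_ne_top).1 hA0
  -- The error n ∫_A |e^{itY/√n} - 1| is at most |t| √n ∫_A |Y|. By Cauchy–Schwarz, √n ∫_A |Y| ≤ √(n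
  -- P(A) ∫_A Y²), where n P(A) converges and ∫_A Y² → 0 by integrability of Y².
  have hroot : Tendsto (fun n : ℕ => √n * ∫ ω in A n, |Y ω| ∂P) atTop (𝓝 0) := by
    have hlim : Tendsto (fun n : ℕ => √((n * P.real (A n)) * ∫ ω in A n, Y ω ^ 2 ∂P)) atTop
        (𝓝 0) := by
      simpa using (hτ.mul hr).sqrt
    refine squeeze_zero (fun n => ?_) (fun n => ?_) hlim
    · exact mul_nonneg (Real.sqrt_nonneg _) (integral_nonneg fun ω => abs_nonneg _)
    · refine Real.le_sqrt_of_sq_le ?_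
      rw [mul_pow, Real.sq_sqrt (Nat.cast_nonneg n), mul_assoc]
      exact mul_le_mul_of_nonneg_left (sq_setIntegral_abs_le hY (A n)) (Nat.cast_nonneg n)
  have hint : ∀ n : ℕ, Integrable
      (fun ω => Complex.exp (Complex.I * ((√n)⁻¹ * t * Y ω : ℝ))) (P.restrict (A n)) := fun n => by
    refine Integrable.of_bound (by fun_prop) 1 (Eventually.of_forall fun ω => ?_)
    rw [mul_comm, Complex.norm_exp_ofReal_mul_I]
  have hdiff : Tendsto (fun n : ℕ => (n : ℂ) *
      ∫ ω in A n, (Complex.exp (Complex.I * ((√n)⁻¹ * t * Y ω : ℝ)) - 1) ∂P) atTop (𝓝 0) := by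
    refine squeeze_zero_norm (fun n => ?_) (by simpa using hroot.const_mul |t|)
    have hb : ‖∫ ω in A n, (Complex.exp (Complex.I * ((√n)⁻¹ * t * Y ω : ℝ)) - 1) ∂P‖
        ≤ ∫ ω in A n, (√n)⁻¹ * |t| * |Y ω| ∂P := by
      refine norm_integral_le_of_norm_le ?_ (Eventually.of_forall fun ω => ?_)
      · exact ((hY.integrable (by norm_num)).abs.integrableOn).const_mul _
      · refine Real.norm_exp_I_mul_ofReal_sub_one_le.trans_eq ?_
        rw [Real.norm_eq_abs, abs_mul, abs_mul, abs_of_nonneg (inv_nonneg.2 (Real.sqrt_nonneg _))]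
    rw [norm_mul, Complex.norm_natCast]
    refine (mul_le_mul_of_nonneg_left hb (Nat.cast_nonneg n)).trans_eq ?_
    rw [integral_const_mul]
    have hs : (n : ℝ) * (√n)⁻¹ = √n := by rw [← div_eq_mul_inv, Real.div_sqrt]
    rw [← mul_assoc, ← mul_assoc, hs]
    ring
  have hτ' : Tendsto (fun n : ℕ => ((n * P.real (A n) : ℝ) : ℂ)) atTop (𝓝 (τ : ℂ)) :=
    (Complex.continuous_ofReal.tendsto τ).comp hτ
  have h := hdiff.add hτ'
  rw [zero_add] at h
  refine h.congr fun n => ?_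
  rw [integral_sub (hint n) (integrable_const _), setIntegral_const]
  simp
  ring

/-- Joint characteristic function of an exceedance indicator and a multiple of the variable. -/
theorem charFun_map_indicator_mul {Y : Ω → ℝ} (hm : Measurable Y) (u c : ℝ)
    (s : WithLp 2 (ℝ × ℝ)) :
    charFun (P.map fun ω => WithLp.toLp 2 ((Set.Ioi u).indicator (1 : ℝ → ℝ) (Y ω), c * Y ω)) s
      = charFun (P.map Y) (c * s.snd) + (Complex.exp (s.fst * Complex.I) - 1) *
        ∫ ω in {ω | u < Y ω}, Complex.exp (Complex.I * (c * s.snd * Y ω : ℝ)) ∂P := by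
  have hA : MeasurableSet {ω | u < Y ω} := measurableSet_lt measurable_const hm
  have hind : Measurable fun ω => (Set.Ioi u).indicator (1 : ℝ → ℝ) (Y ω) :=
    (measurable_one.indicator measurableSet_Ioi).comp hm
  have hint : Integrable (fun ω => Complex.exp (Complex.I * (c * s.snd * Y ω : ℝ))) P := by
    refine Integrable.of_bound (by fun_prop) 1 (Eventually.of_forall fun ω => ?_)
    rw [mul_comm, Complex.norm_exp_ofReal_mul_I]
  rw [charFun_apply, charFun_apply, integral_map (by fun_prop) (by fun_prop),
    integral_map (by fun_prop) (by fun_prop), ← integral_indicator hA, ← integral_const_mul,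
    ← integral_add _ ((hint.indicator hA).const_mul _)]
  · refine integral_congr_ae (Eventually.of_forall fun ω => ?_)
    by_cases h : u < Y ω
    · simp [WithLp.prod_inner_apply, h, add_mul, Complex.exp_add, sub_mul]
      ring_nf
    · simp [WithLp.prod_inner_apply, h]
      ring_nf
  · refine hint.congr (Eventually.of_forall fun ω => ?_)
    simp
    ring_nf

end

/-! ### Joint limit of count and sum -/

section

variable {Ω : Type*} [MeasurableSpace Ω] {P : Measure Ω} [IsProbabilityMeasure P]

/-- Second-order Taylor expansion of the characteristic function at 0, evaluated at t / √n. -/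
theorem tendsto_natCast_mul_charFun_sub_one {Y : Ω → ℝ} (hm : Measurable Y)
    (hmean : ∫ ω, Y ω ∂P = 0) (hvar : ∫ ω, Y ω ^ 2 ∂P = 1) (t : ℝ) :
    Tendsto (fun n : ℕ => (n : ℂ) * (charFun (P.map Y) ((√n)⁻¹ * t) - 1)) atTop
      (𝓝 (-(t : ℂ) ^ 2 / 2)) := by
  have h0 : Tendsto (fun n : ℕ => (√n)⁻¹ * t) atTop (𝓝 0) := by
    rw [← zero_mul t]
    exact .mul_const t (tendsto_inv_atTop_zero.comp <| Real.tendsto_sqrt_atTop.comp <|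
      tendsto_natCast_atTop_atTop)
  have hT := (taylor_charFun_two hm.aemeasurable hmean (by simpa using hvar)).comp_tendsto h0
  have hO : (fun n : ℕ => ((√n)⁻¹ * t) ^ 2) =O[atTop] fun n : ℕ => ((n : ℝ))⁻¹ := by
    refine Asymptotics.IsBigO.of_bound (t ^ 2) (Eventually.of_forall fun n => ?_)
    rw [mul_pow, inv_pow, Real.sq_sqrt (Nat.cast_nonneg n), norm_mul, mul_comm, norm_pow,
      Real.norm_eq_abs t, sq_abs]
  have h1 := (hT.trans_isBigO hO).norm_norm.tendsto_div_nhds_zero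
  have h2 : Tendsto (fun n : ℕ => (n : ℂ) * (charFun (P.map Y) ((√n)⁻¹ * t)
      - (1 - (((√n)⁻¹ * t : ℝ) : ℂ) ^ 2 / 2))) atTop (𝓝 0) := by
    refine tendsto_zero_iff_norm_tendsto_zero.2 (h1.congr fun n => ?_)
    simp [div_eq_mul_inv, mul_comm]
  rw [← zero_add (-(t : ℂ) ^ 2 / 2)]
  refine (h2.add_const _).congr' ?_
  filter_upwards [eventually_ge_atTop 1] with n hn
  have hn0 : (n : ℂ) ≠ 0 := by exact_mod_cast (by omega : n ≠ 0)
  have hs : ((√n : ℝ) : ℂ) ^ 2 = n := by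
    rw [← Complex.ofReal_pow, Real.sq_sqrt (Nat.cast_nonneg n), Complex.ofReal_natCast]
  push_cast
  rw [mul_pow, inv_pow, hs]
  field_simp
  ring

variable {X : ℕ → Ω → ℝ}

theorem toLp_exceedanceCount_eq_sum (u c : ℝ) (n : ℕ) (x : ℕ → ℝ) :
    WithLp.toLp 2 (exceedanceCount u n x, c * ∑ i ∈ Finset.range n, x i)
      = ∑ i ∈ Finset.range n, WithLp.toLp 2 ((Set.Ioi u).indicator (1 : ℝ → ℝ) (x i), c * x i) := by
  simp only [exceedanceCount, Finset.mul_sum]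
  induction n with
  | zero => rfl
  | succ n ih =>
    rw [Finset.sum_range_succ, Finset.sum_range_succ, Finset.sum_range_succ, ← ih]
    rfl

omit [IsProbabilityMeasure P] in
theorem charFun_map_exceedanceCount_sum (hX : ∀ i, Measurable (X i)) (hindep : iIndepFun X P)
    (hident : ∀ i, IdentDistrib (X i) (X 0) P P) (u c : ℝ) (n : ℕ) (s : WithLp 2 (ℝ × ℝ)) :
    charFun (P.map fun ω => WithLp.toLp 2
      (exceedanceCount u n (fun i => X i ω), c * ∑ i ∈ Finset.range n, X i ω)) s
      = charFun (P.map fun ω =>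
          WithLp.toLp 2 ((Set.Ioi u).indicator (1 : ℝ → ℝ) (X 0 ω), c * X 0 ω)) s ^ n := by
  have hg : Measurable fun x : ℝ => WithLp.toLp 2 ((Set.Ioi u).indicator (1 : ℝ → ℝ) x, c * x) := by
    have : Measurable ((Set.Ioi u).indicator (1 : ℝ → ℝ)) :=
      measurable_one.indicator measurableSet_Ioi
    fun_prop
  simp_rw [toLp_exceedanceCount_eq_sum]
  have h := ((hindep.comp
    (fun _ x => WithLp.toLp 2 ((Set.Ioi u).indicator (1 : ℝ → ℝ) x, c * x))
    fun _ => hg).restrict (Finset.range n)).charFun_map_fun_finsetSum_eq_prod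
    fun i _ => (hg.comp (hX i)).aemeasurable
  refine (congrFun h s).trans ?_
  rw [Finset.prod_apply, ← Finset.card_range n, ← Finset.prod_const, Finset.card_range]
  refine Finset.prod_congr rfl fun i _ => ?_
  rw [((hident i).comp hg).map_eq]
  rfl

/-- The joint law of exceedance count and normalized sum tends to Poisson times normal. -/
theorem tendsto_charFun_exceedanceCount_sum (hX : ∀ i, Measurable (X i)) (hindep : iIndepFun X P)
    (hident : ∀ i, IdentDistrib (X i) (X 0) P P)
    (hmean : ∫ ω, X 0 ω ∂P = 0) (hvar : ∫ ω, X 0 ω ^ 2 ∂P = 1) {u : ℕ → ℝ} {τ : NNReal}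
    (hτ : Tendsto (fun n : ℕ => n * P.real {ω | u n < X 0 ω}) atTop (𝓝 (τ : ℝ)))
    (s : WithLp 2 (ℝ × ℝ)) :
    Tendsto (fun n : ℕ => charFun (P.map fun ω => WithLp.toLp 2
      (exceedanceCount (u n) n (fun i => X i ω), (√n)⁻¹ * ∑ i ∈ Finset.range n, X i ω)) s) atTop
      (𝓝 (charFun ((((poissonMeasure τ).map (Nat.cast : ℕ → ℝ)).prod
        (gaussianReal 0 1)).map (WithLp.toLp 2)) s)) := by
  have hL2 : MemLp (X 0) 2 P := (memLp_two_iff_integrable_sq (hX 0).aestronglyMeasurable).2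
    (.of_integral_ne_zero (by rw [hvar]; norm_num))
  have h1 := tendsto_natCast_mul_charFun_sub_one (hX 0) hmean hvar s.snd
  have h2 := tendsto_natCast_mul_setIntegral_cexp (hX 0) hL2 hτ s.snd
  have h3 := Complex.tendsto_one_add_pow_exp_of_tendsto
    (g := fun n => charFun (P.map fun ω => WithLp.toLp 2
      ((Set.Ioi (u n)).indicator (1 : ℝ → ℝ) (X 0 ω), (√n)⁻¹ * X 0 ω)) s - 1)
    ((h1.add (h2.const_mul (Complex.exp (s.fst * Complex.I) - 1))).congr fun n => by
      rw [charFun_map_indicator_mul (hX 0)]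
      ring)
  have hlim : charFun ((((poissonMeasure τ).map (Nat.cast : ℕ → ℝ)).prod
      (gaussianReal 0 1)).map (WithLp.toLp 2)) s
      = Complex.exp (-(s.snd : ℂ) ^ 2 / 2 + (Complex.exp (s.fst * Complex.I) - 1) * (τ : ℝ)) := by
    rw [charFun_prod, charFun_map_cast_poissonMeasure, charFun_gaussianReal, ← Complex.exp_add]
    congr 1
    simp
    ring
  rw [hlim]
  refine h3.congr fun n => ?_
  rw [charFun_map_exceedanceCount_sum hX hindep hident]
  ring

end

/-! ### From the law of the maximum to exceedance rates -/

theorem tendsto_natCast_mul_of_tendsto_one_sub_pow {p : ℕ → ℝ} (hp1 : ∀ n, p n ≤ 1) {g : ℝ}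
    (hg : 0 < g) (h : Tendsto (fun n => (1 - p n) ^ n) atTop (𝓝 g)) :
    Tendsto (fun n : ℕ => n * p n) atTop (𝓝 (-Real.log g)) := by
  have hlog : Tendsto (fun n : ℕ => n * Real.log (1 - p n)) atTop (𝓝 (Real.log g)) :=
    (h.log hg.ne').congr fun n => Real.log_pow _ _
  have hpos : ∀ᶠ n in atTop, 0 < 1 - p n := by
    filter_upwards [h.eventually (lt_mem_nhds hg), eventually_ge_atTop 1] with n hn hn1
    refine lt_of_le_of_ne (sub_nonneg.2 (hp1 n)) fun h0 => ?_
    rw [← h0, zero_pow (by omega)] at hn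
    exact lt_irrefl _ hn
  have hone : Tendsto (fun n => 1 - p n) atTop (𝓝 1) := by
    have h0 := (hlog.mul (tendsto_inv_atTop_nhds_zero_nat (𝕜 := ℝ))).rexp
    rw [mul_zero, Real.exp_zero] at h0
    refine h0.congr' ?_
    filter_upwards [hpos, eventually_ge_atTop 1] with n hn hn1
    have : (n : ℝ) ≠ 0 := by positivity
    rw [mul_comm, inv_mul_cancel_left₀ this, Real.exp_log hn]
  -- With q = 1 - p, the bounds 1 - 1/q ≤ log q ≤ q - 1 squeeze n p between -q n log q and -n log q.
  have hlow : Tendsto (fun n : ℕ => (1 - p n) * -(n * Real.log (1 - p n))) atTop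
      (𝓝 (-Real.log g)) := by
    simpa using hone.mul hlog.neg
  refine tendsto_of_tendsto_of_tendsto_of_le_of_le' hlow hlog.neg ?_ ?_
  · filter_upwards [hpos] with n hn
    have h1 := mul_le_mul_of_nonneg_left (Real.one_sub_inv_le_log_of_pos hn) hn.le
    rw [mul_sub, mul_inv_cancel₀ hn.ne'] at h1
    nlinarith [(Nat.cast_nonneg n : (0 : ℝ) ≤ n)]
  · filter_upwards [hpos] with n hn
    have h1 := Real.log_le_sub_one_of_pos hn
    nlinarith [(Nat.cast_nonneg n : (0 : ℝ) ≤ n)]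

/-- Either p ≤ 1/2 and (1 - p/2)⁴ ≤ 1 - p, or p ≥ 1/2 and (1 - p/2)⁴ ≤ (3/4)⁴; both bounds have
vanishing `n`-th powers. -/
theorem tendsto_one_sub_half_pow {p : ℕ → ℝ} (hp0 : ∀ n, 0 ≤ p n) (hp1 : ∀ n, p n ≤ 1)
    (h : Tendsto (fun n => (1 - p n) ^ n) atTop (𝓝 0)) :
    Tendsto (fun n => (1 - p n / 2) ^ n) atTop (𝓝 0) := by
  have hsum : Tendsto (fun n => (1 - p n) ^ n + ((3 / 4 : ℝ) ^ 4) ^ n) atTop (𝓝 0) := by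
    simpa using h.add (tendsto_pow_atTop_nhds_zero_of_lt_one (r := (3 / 4 : ℝ) ^ 4)
      (by norm_num) (by norm_num))
  have h4 : Tendsto (fun n => ((1 - p n / 2) ^ n) ^ 4) atTop (𝓝 0) := by
    refine squeeze_zero (fun n => by positivity) (fun n => ?_) hsum
    rw [pow_right_comm]
    have ha : 0 ≤ (1 - p n) ^ n := pow_nonneg (sub_nonneg.2 (hp1 n)) n
    rcases le_total (p n) (1 / 2) with hn | hn
    · refine le_add_of_le_of_nonneg (pow_le_pow_left₀ (by positivity) ?_ n) (by positivity)
      have h2 : (1 - p n / 2) ^ 2 ≤ 1 - 3 / 4 * p n := by nlinarith [hp0 n]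
      nlinarith [hp0 n, pow_le_pow_left₀ (sq_nonneg (1 - p n / 2)) h2 2]
    · refine le_add_of_nonneg_of_le ha (pow_le_pow_left₀ (by positivity) ?_ n)
      exact pow_le_pow_left₀ (by linarith [hp1 n]) (by linarith) 4
  have hrt := h4.sqrt.sqrt
  rw [Real.sqrt_zero, Real.sqrt_zero] at hrt
  refine hrt.congr fun n => ?_
  have hb : 0 ≤ 1 - p n / 2 := by linarith [hp1 n]
  rw [show ((1 - p n / 2) ^ n) ^ 4 = (((1 - p n / 2) ^ n) ^ 2) ^ 2 by ring,
    Real.sqrt_sq (by positivity), Real.sqrt_sq (by positivity)]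

/-! ### Exceedance probabilities and weak convergence -/

section

variable {Ω : Type*} [MeasurableSpace Ω] {P : Measure Ω} [IsProbabilityMeasure P]
  {X : ℕ → Ω → ℝ}

/-- Probability generating function of the exceedance count. -/
theorem integral_pow_card_exceedances (hX : ∀ i, Measurable (X i)) (hindep : iIndepFun X P)
    (hident : ∀ i, IdentDistrib (X i) (X 0) P P) (u z : ℝ) (n : ℕ) :
    ∫ ω, z ^ ((Finset.range n).filter (fun i => u < X i ω)).card ∂P
      = (1 - (1 - z) * P.real {ω | u < X 0 ω}) ^ n := by
  set f : ℝ → ℝ := fun x => 1 - (1 - z) * (Set.Ioi u).indicator 1 x with hf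
  have hfm : Measurable f :=
    measurable_const.sub ((measurable_one.indicator measurableSet_Ioi).const_mul _)
  have hprod : ∀ ω, z ^ ((Finset.range n).filter (fun i => u < X i ω)).card
      = ∏ i : Fin n, f (X i ω) := fun ω => by
    rw [← Finset.prod_range (fun i => f (X i ω)), ← Finset.prod_const, Finset.prod_filter]
    refine Finset.prod_congr rfl fun i _ => ?_
    by_cases h : u < X i ω <;> simp [hf, h]
  simp_rw [hprod]
  have h := (hindep.precomp (g := fun i : Fin n => (i : ℕ)) Fin.val_injective).integral_fun_prod_comp
    (f := fun _ => f) (fun i => (hX i).aemeasurable) (fun i => hfm.aestronglyMeasurable)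
  rw [h]
  have hone : ∀ i : ℕ, ∫ ω, f (X i ω) ∂P = 1 - (1 - z) * P.real {ω | u < X 0 ω} := fun i => by
    have hA : MeasurableSet {ω | u < X 0 ω} := measurableSet_lt measurable_const (hX 0)
    have he : ∫ ω, f (X i ω) ∂P = ∫ ω, f (X 0 ω) ∂P := ((hident i).comp hfm).integral_eq
    have hi : (fun ω => f (X 0 ω))
        = fun ω => 1 - (1 - z) * ({ω | u < X 0 ω}).indicator (1 : Ω → ℝ) ω := by
      ext ω
      by_cases h : u < X 0 ω <;> simp [hf, h]
    have hint : Integrable (({ω | u < X 0 ω}).indicator (1 : Ω → ℝ)) P :=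
      (integrable_const (1 : ℝ)).indicator hA
    rw [he, hi, integral_sub (integrable_const _) (hint.const_mul _), integral_const_mul,
      integral_indicator_one hA]
    simp
  simp [hone]

/-- The generating function at z = 0, since 0^N is the indicator of N = 0. -/
theorem measureReal_exceedanceCount_lt_one (hX : ∀ i, Measurable (X i)) (hindep : iIndepFun X P)
    (hident : ∀ i, IdentDistrib (X i) (X 0) P P) (u : ℝ) (n : ℕ) :
    P.real {ω | exceedanceCount u n (fun i => X i ω) < (1 : ℕ)}
      = (1 - P.real {ω | u < X 0 ω}) ^ n := by
  have h := integral_pow_card_exceedances hX hindep hident u 0 n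
  rw [sub_zero, one_mul] at h
  rw [← h, ← integral_indicator_one
    (measurableSet_lt (measurable_exceedanceCount hX u n) measurable_const)]
  refine integral_congr_ae (Eventually.of_forall fun ω => ?_)
  simp only [Set.indicator_apply, Set.mem_ofPred_eq, exceedanceCount_eq_card, Nat.cast_lt,
    Nat.lt_one_iff, zero_pow_eq, Pi.one_apply]

/-- Markov's inequality with the generating function at z = 1/2: 1{N < k} ≤ 2^k 2^{-N}. -/
theorem tendsto_measureReal_exceedanceCount_lt (hX : ∀ i, Measurable (X i))
    (hindep : iIndepFun X P) (hident : ∀ i, IdentDistrib (X i) (X 0) P P) {u : ℕ → ℝ}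
    (hu : Tendsto (fun n => (1 - P.real {ω | u n < X 0 ω}) ^ n) atTop (𝓝 0)) (k : ℕ) :
    Tendsto (fun n => P.real {ω | exceedanceCount (u n) n (fun i => X i ω) < k}) atTop (𝓝 0) := by
  have h0 := (tendsto_one_sub_half_pow (fun n => measureReal_nonneg)
    (fun n => measureReal_le_one) hu).const_mul (2 ^ k : ℝ)
  rw [mul_zero] at h0
  refine squeeze_zero (fun n => measureReal_nonneg) (fun n => ?_) h0
  have hS := measurableSet_lt (measurable_exceedanceCount hX (u n) n) (measurable_const (a := (k : ℝ)))
  have h := integral_pow_card_exceedances hX hindep hident (u n) (1 / 2) n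
  rw [show (1 : ℝ) - (1 - 1 / 2) * P.real {ω | u n < X 0 ω} = 1 - P.real {ω | u n < X 0 ω} / 2 by
    ring] at h
  rw [← h, ← integral_const_mul, ← integral_indicator_one hS]
  have hmeas : Measurable fun ω =>
      (1 / 2 : ℝ) ^ ((Finset.range n).filter (fun i => u n < X i ω)).card := by
    have := measurable_exceedanceCount hX (u n) n
    simp_rw [exceedanceCount_eq_card] at this
    have h2 := measurable_const.pow this (f := fun _ : Ω => (1 / 2 : ℝ))
    simpa only [Real.rpow_natCast] using h2
  refine integral_mono ((integrable_const (1 : ℝ)).indicator hS) ?_ fun ω => ?_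
  · refine Integrable.const_mul (Integrable.of_bound hmeas.aestronglyMeasurable 1
      (Eventually.of_forall fun ω => ?_)) _
    rw [Real.norm_of_nonneg (by positivity)]
    exact pow_le_one₀ (by norm_num) (by norm_num)
  · simp only [Set.indicator_apply, Set.mem_ofPred_eq, Pi.one_apply]
    split_ifs with hω
    · rw [exceedanceCount_eq_card, Nat.cast_lt] at hω
      rw [one_div, inv_pow, ← div_eq_mul_inv, one_le_div (by positivity)]
      exact pow_le_pow_right₀ (by norm_num) hω.le
    · positivity

/-- Exceedance counts and normalized sums are asymptotically independent on continuity sets. -/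
theorem tendsto_measureReal_exceedanceCount_sum (hX : ∀ i, Measurable (X i))
    (hindep : iIndepFun X P) (hident : ∀ i, IdentDistrib (X i) (X 0) P P)
    (hmean : ∫ ω, X 0 ω ∂P = 0) (hvar : ∫ ω, X 0 ω ^ 2 ∂P = 1) {u : ℕ → ℝ} {τ : NNReal}
    (hτ : Tendsto (fun n : ℕ => n * P.real {ω | u n < X 0 ω}) atTop (𝓝 (τ : ℝ)))
    {A B : Set ℝ} (hA : MeasurableSet A) (hB : MeasurableSet B)
    (hA0 : (poissonMeasure τ).map (Nat.cast : ℕ → ℝ) (frontier A) = 0)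
    (hB0 : gaussianReal 0 1 (frontier B) = 0) :
    Tendsto (fun n : ℕ => P.real {ω | exceedanceCount (u n) n (fun i => X i ω) ∈ A ∧
        (√n)⁻¹ * ∑ i ∈ Finset.range n, X i ω ∈ B}) atTop
      (𝓝 (((poissonMeasure τ).map (Nat.cast : ℕ → ℝ)).real A * (gaussianReal 0 1).real B)) := by
  set Z : ℕ → Ω → WithLp 2 (ℝ × ℝ) := fun n ω => WithLp.toLp 2
      (exceedanceCount (u n) n (fun i => X i ω), (√n)⁻¹ * ∑ i ∈ Finset.range n, X i ω) with hZ
  have hZm : ∀ n, Measurable (Z n) := fun n => by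
    have := measurable_exceedanceCount hX (u n) n
    fun_prop
  set ν := (((poissonMeasure τ).map (Nat.cast : ℕ → ℝ)).prod
    (gaussianReal 0 1)).map (WithLp.toLp 2) with hν
  have hνp : IsProbabilityMeasure ν := Measure.isProbabilityMeasure_map (by fun_prop)
  have hZp : ∀ n, IsProbabilityMeasure (P.map (Z n)) := fun n =>
    Measure.isProbabilityMeasure_map (hZm n).aemeasurable
  let ζ : ℕ → ProbabilityMeasure (WithLp 2 (ℝ × ℝ)) := fun n => ⟨P.map (Z n), hZp n⟩
  let ν' : ProbabilityMeasure (WithLp 2 (ℝ × ℝ)) := ⟨ν, hνp⟩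
  have hweak : Tendsto ζ atTop (𝓝 ν') :=
    ProbabilityMeasure.tendsto_of_tendsto_charFun fun s =>
      tendsto_charFun_exceedanceCount_sum hX hindep hident hmean hvar hτ s
  have hof : Measurable (WithLp.ofLp : WithLp 2 (ℝ × ℝ) → ℝ × ℝ) := by fun_prop
  have hofc : Continuous (WithLp.ofLp : WithLp 2 (ℝ × ℝ) → ℝ × ℝ) := by fun_prop
  have hνap : ∀ S : Set (ℝ × ℝ), MeasurableSet S → ν (WithLp.ofLp ⁻¹' S)
      = ((poissonMeasure τ).map (Nat.cast : ℕ → ℝ)).prod (gaussianReal 0 1) S := fun S hS => by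
    rw [hν, Measure.map_apply (by fun_prop) (hof hS)]
    rfl
  -- The frontier of A × B lies over (closure A × frontier B) ∪ (frontier A × closure B), which is
  -- null for the product law.
  have hfr : ν (frontier (WithLp.ofLp ⁻¹' (A ×ˢ B))) = 0 := by
    refine measure_mono_null (hofc.frontier_preimage_subset _) ?_
    rw [hνap _ isClosed_frontier.measurableSet, frontier_prod_eq]
    refine measure_union_null ?_ ?_ <;> simp [Measure.prod_prod, hA0, hB0]
  have hlim := ProbabilityMeasure.tendsto_measure_of_null_frontier_of_tendsto' hweak hfr
  have hlim' := (ENNReal.tendsto_toReal (measure_ne_top ν _)).comp hlim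
  have hval : (ν (WithLp.ofLp ⁻¹' (A ×ˢ B))).toReal
      = ((poissonMeasure τ).map (Nat.cast : ℕ → ℝ)).real A * (gaussianReal 0 1).real B := by
    rw [hνap _ (hA.prod hB), Measure.prod_prod, ENNReal.toReal_mul]
    rfl
  rw [← hval]
  refine hlim'.congr fun n => ?_
  exact congrArg ENNReal.toReal (Measure.map_apply (hZm n) (hof (hA.prod hB)))

theorem map_cast_poissonMeasure_real_Iic (τ : NNReal) (k : ℕ) :
    ((poissonMeasure τ).map (Nat.cast : ℕ → ℝ)).real (Set.Iic (k - 1 / 2))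
      = Real.exp (-τ) * ∑ i ∈ Finset.range k, (τ : ℝ) ^ i / (Nat.factorial i : ℝ) := by
  have hset : (Nat.cast : ℕ → ℝ) ⁻¹' Set.Iic (k - 1 / 2) = (Finset.range k : Set ℕ) := by
    ext m
    simp only [Set.mem_preimage, Set.mem_Iic, Finset.coe_range, Set.mem_Iio]
    constructor
    · intro h
      have : (m : ℝ) < k := by linarith
      exact_mod_cast this
    · intro h
      have : (m : ℝ) + 1 ≤ k := by exact_mod_cast h
      linarith
  rw [map_measureReal_apply (by fun_prop) measurableSet_Iic, hset, ← sum_measureReal_singleton,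
    Finset.mul_sum]
  refine Finset.sum_congr rfl fun i _ => ?_
  rw [poissonMeasure_real_singleton, mul_div_assoc]

theorem map_cast_poissonMeasure_frontier_Iic (τ : NNReal) (k : ℕ) :
    (poissonMeasure τ).map (Nat.cast : ℕ → ℝ) (frontier (Set.Iic ((k : ℝ) - 1 / 2))) = 0 := by
  rw [frontier_Iic, Measure.map_apply (by fun_prop) (measurableSet_singleton _)]
  convert measure_empty (μ := poissonMeasure τ)
  ext m
  simp only [Set.mem_preimage, Set.mem_singleton_iff, Set.mem_empty_iff_false, iff_false]
  intro h
  have h2 : ((2 * m + 1 : ℕ) : ℝ) = (2 * k : ℕ) := by push_cast; linarith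
  have := Nat.cast_injective h2
  omega

theorem gaussianReal_frontier_Iic (y : ℝ) : gaussianReal 0 1 (frontier (Set.Iic y)) = 0 := by
  have := nullSingletonClass_gaussianReal (μ := 0) (v := 1) one_ne_zero
  rw [frontier_Iic, measure_singleton]

end

/-! ### The limit theorem -/

theorem theorem2p3 {Ω : Type*} [MeasurableSpace Ω] (P : Measure Ω) [IsProbabilityMeasure P]
    (X : ℕ → Ω → ℝ) (hX : ∀ i, Measurable (X i))
    (hindep : iIndepFun X P) (hident : ∀ i, IdentDistrib (X i) (X 0) P P)
    (hmean : ∫ ω, X 0 ω ∂P = 0) (hvar : ∫ ω, (X 0 ω) ^ 2 ∂P = 1)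
    (a b : ℕ → ℝ) (ha : ∀ n : ℕ, 1 ≤ n → 0 < a n)
    (G : ℝ → ℝ) (hG : IsExtremeValueCDF G)
    (hmax : ∀ x : ℝ, Tendsto
      (fun n : ℕ => P.real {ω | a n * (kthMax n 1 (fun i => X i ω) - b n) ≤ x})
      atTop (𝓝 (G x)))
    (k : ℕ) (hk : 1 ≤ k) :
    (∀ x y : ℝ, Tendsto
      (fun n : ℕ => P.real {ω | a n * (kthMax n k (fun i => X i ω) - b n) ≤ x ∧
        (∑ i ∈ Finset.range n, X i ω) / √(n : ℝ) ≤ y})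
      atTop
      (𝓝 ((G x * ∑ i ∈ Finset.range k, (-Real.log (G x)) ^ i / (Nat.factorial i : ℝ))
        * stdNormalCDF y))) ∧
    AsymptoticallyIndependent P
      (fun n ω => a n * (kthMax n k (fun i => X i ω) - b n))
      (fun n ω => (∑ i ∈ Finset.range n, X i ω) / √(n : ℝ)) := by
  set N : ℝ → ℕ → Ω → ℝ := fun x n ω => exceedanceCount (x / a n + b n) n (fun i => X i ω) with hN
  have hevent : ∀ (x : ℝ) (j n : ℕ), 1 ≤ j → j ≤ n → ∀ ω,
      a n * (kthMax n j (fun i => X i ω) - b n) ≤ x ↔ N x n ω < j := fun x j n hj hjn ω => by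
    rw [← kthMax_le_iff hj hjn, ← le_div_iff₀' (ha n (hj.trans hjn)), sub_le_iff_le_add]
  have hpow : ∀ x, Tendsto (fun n => (1 - P.real {ω | x / a n + b n < X 0 ω}) ^ n) atTop
      (𝓝 (G x)) := fun x => by
    refine (hmax x).congr' ?_
    filter_upwards [eventually_ge_atTop 1] with n hn
    rw [← measureReal_exceedanceCount_lt_one hX hindep hident]
    simp only [hevent x 1 n le_rfl hn, hN]
  have hG0 : ∀ x, 0 ≤ G x := fun x => ge_of_tendsto' (hmax x) fun n => measureReal_nonneg
  have hG1 : ∀ x, G x ≤ 1 := fun x => le_of_tendsto' (hmax x) fun n => measureReal_le_one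
  have hzero : ∀ x, G x = 0 → Tendsto
      (fun n => P.real {ω | a n * (kthMax n k (fun i => X i ω) - b n) ≤ x}) atTop (𝓝 0) :=
    fun x hx => by
      refine (tendsto_measureReal_exceedanceCount_lt hX hindep hident (hx ▸ hpow x) k).congr' ?_
      filter_upwards [eventually_ge_atTop k] with n hn
      simp only [hevent x k n hk hn, hN]
  have hjoint0 : ∀ x y, G x = 0 → Tendsto
      (fun n : ℕ => P.real {ω | a n * (kthMax n k (fun i => X i ω) - b n) ≤ x ∧
        (∑ i ∈ Finset.range n, X i ω) / √(n : ℝ) ≤ y}) atTop (𝓝 0) := fun x y hx =>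
    squeeze_zero (fun n => measureReal_nonneg)
      (fun n => measureReal_mono fun ω hω => hω.1) (hzero x hx)
  have hrate : ∀ x, G x ≠ 0 → ∃ τ : NNReal, (τ : ℝ) = -Real.log (G x) ∧
      Tendsto (fun n : ℕ => n * P.real {ω | x / a n + b n < X 0 ω}) atTop (𝓝 (τ : ℝ)) :=
    fun x hx => ⟨⟨_, neg_nonneg.2 (Real.log_nonpos (hG0 x) (hG1 x))⟩, rfl,
      tendsto_natCast_mul_of_tendsto_one_sub_pow (fun n => measureReal_le_one)
        (lt_of_le_of_ne (hG0 x) (Ne.symm hx)) (hpow x)⟩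
  -- A general `B` serves twice: a half-line gives the joint law, the whole line gives the marginal
  -- law of the order statistic.
  have hpos : ∀ x, G x ≠ 0 → ∀ B : Set ℝ, MeasurableSet B → gaussianReal 0 1 (frontier B) = 0 →
      Tendsto (fun n : ℕ => P.real {ω | a n * (kthMax n k (fun i => X i ω) - b n) ≤ x ∧
        (∑ i ∈ Finset.range n, X i ω) / √(n : ℝ) ∈ B}) atTop
      (𝓝 ((G x * ∑ i ∈ Finset.range k, (-Real.log (G x)) ^ i / (Nat.factorial i : ℝ))
        * (gaussianReal 0 1).real B)) := fun x hx B hB hB0 => by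
    obtain ⟨τ, hτ, hlim⟩ := hrate x hx
    have h := tendsto_measureReal_exceedanceCount_sum hX hindep hident hmean hvar hlim
      measurableSet_Iic hB (map_cast_poissonMeasure_frontier_Iic τ k) hB0
    rw [map_cast_poissonMeasure_real_Iic, hτ, neg_neg,
      Real.exp_log (lt_of_le_of_ne (hG0 x) (Ne.symm hx))] at h
    refine h.congr' ?_
    filter_upwards [eventually_ge_atTop k] with n hn
    simp only [hevent x k n hk hn, hN, exceedanceCount_lt_natCast_iff, Set.mem_Iic,
      div_eq_inv_mul]
  refine ⟨fun x y => ?_, fun x y => ?_⟩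
  · by_cases hx : G x = 0
    · simpa [hx] using hjoint0 x y hx
    · simpa [stdNormalCDF, cdf_eq_real] using
        hpos x hx (Set.Iic y) measurableSet_Iic (gaussianReal_frontier_Iic y)
  · by_cases hx : G x = 0
    · have hprod := squeeze_zero
        (fun n => mul_nonneg measureReal_nonneg measureReal_nonneg)
        (fun n => mul_le_of_le_one_right measureReal_nonneg
          (measureReal_le_one (μ := P) (s := {ω | (∑ i ∈ Finset.range n, X i ω) / √(n : ℝ) ≤ y})))
        (hzero x hx)
      simpa using (hjoint0 x y hx).sub hprod
    · have hU : Tendsto (fun n => P.real {ω | a n * (kthMax n k (fun i => X i ω) - b n) ≤ x})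
          atTop (𝓝 (G x * ∑ i ∈ Finset.range k,
            (-Real.log (G x)) ^ i / (Nat.factorial i : ℝ))) := by
        simpa using hpos x hx Set.univ MeasurableSet.univ (by simp)
      have hV : Tendsto (fun n : ℕ => P.real {ω | (∑ i ∈ Finset.range n, X i ω) / √(n : ℝ) ≤ y})
          atTop (𝓝 ((gaussianReal 0 1).real (Set.Iic y))) := by
        -- The central limit theorem for the sum is the case where the count is unrestricted; any
        -- threshold with a finite rate will do.
        obtain ⟨τ, -, hlim⟩ := hrate x hx
        simpa [div_eq_inv_mul] using tendsto_measureReal_exceedanceCount_sum hX hindep hident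
          hmean hvar hlim MeasurableSet.univ measurableSet_Iic (by simp)
          (gaussianReal_frontier_Iic y)
      have h := (hpos x hx (Set.Iic y) measurableSet_Iic (gaussianReal_frontier_Iic y)).sub
        (hU.mul hV)
      rw [sub_self] at h
      exact h
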